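/- Throughout, $p$ is a prime, $\nu_p$ is the $p$-adic valuation, $\sigma_p(m)$ is the sum of the base $p$ digits of $m$, and $S(n,k)$ is the Stirling number of the second kind. For $l\in\mathbb Z$ the higher order Bernoulli polynomials $B_m^{(l)}(x)\in\mathbb Q[x]$ are defined by $$\left(\frac{t}{e^t-1}\right)^{l}e^{tx}=\sum_{m\ge 0}B_m^{(l)}(x)\frac{t^m}{m!},$$ and the maximum pole of a rational polynomial is the exponent of the highest power of $p$ occurring in the denominator of any of its coefficients. For $0<k\le n$ let $M$ be the maximum pole of $B_{n-k}^{(-k)}(x)$. The almost minimum zero estimate for $S(n,k)$ is $\nu_p(S(n,k))\ge \nu_p\binom nk-M$, and $S(n,k)$ is called an almost minimum zero case if equality holds in it. Write $n=\sum_i n_ip^i$ in base $p$. A segment of $n$ is a number $u\,p^a+\sum_{a<i<b}n_ip^i+v\,p^b$ with $a<b$, $0\le u\le n_a$ and $0\le v\le n_b$; a bottom segment of $n$ is a number $\sum_{i<b}n_ip^i+v\,p^b$ with $b\ge 0$ and $0\le v\le n_b$. **Theorem.** Let $n=c\,p^h$ with integers $c,h\ge 0$, let $c_0$ be the last base $p$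 digit of $c$, and let $k'$ be the least positive residue of $k$ modulo $p-1$, that is, $1\le k'\le p-1$ and $k\equiv k'\pmod{p-1}$. Assume that $0<k\le \min\{c_0,k'\}\,p^h$. (a) If $\sigma_p(n)\ge k'$, then there is a smallest segment $n'$ of $n$ with $\sigma_p(n')=k'$; it is a bottom segment of $n$ and $k\le n'$. The maximum pole of $B_{n-k}^{(-k)}(x)$ equals $\sigma_p(n'-k)/(p-1)$. The almost minimum zero estimate for $S(n,k)$ is $$\nu_p(S(n,k))\ \ge\ \frac{\sigma_p(k)-k'}{p-1},$$ that is, $\nu_p\binom nk-M=(\sigma_p(k)-k')/(p-1)$, and this lower bound holds. (b) If $n\equiv k\pmod{p-1}$, then $S(n,k)$ is an almost minimum zero case and $$\nu_p(S(n,k))=\frac{\sigma_p(k)-k'}{p-1}.$$ -/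

import Mathlib

namespace StirlingPole

/-- The digit sum `σ_p(n)` of the base `p` expansion of `n`. -/
def digitSum (p n : ℕ) : ℕ := (Nat.digits p n).sum

/-- The coefficient `n_i` of `p ^ i` in the base `p` expansion of `n`. -/
def digit (p n i : ℕ) : ℕ := n / p ^ i % p

/-- `m` is a segment of the base `p` expansion of `n`: a block of consecutive terms `n_i * p ^ i`
in which the two extreme digits may be replaced by smaller ones (also by `0`). -/
def IsSegment (p n m : ℕ) : Prop :=
  ∃ a b u v : ℕ, a < b ∧ u ≤ digit p n a ∧ v ≤ digit p n b ∧
    m = u * p ^ a + ∑ i ∈ Finset.Ioo a b, digit p n i * p ^ i + v * p ^ b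

/-- `m` is a bottom segment of the base `p` expansion of `n`: all the terms `n_i * p ^ i` below
some place `b`, and a term at place `b` whose digit is at most `n_b`. -/
def IsBottomSegment (p n m : ℕ) : Prop :=
  ∃ b v : ℕ, v ≤ digit p n b ∧ m = ∑ i ∈ Finset.range b, digit p n i * p ^ i + v * p ^ b

/-- The power series `(e ^ t - 1) / t = ∑ t ^ n / (n + 1)!`. -/
noncomputable def expSubOneDiv : PowerSeries ℚ :=
  PowerSeries.mk fun n => 1 / ((n + 1).factorial : ℚ)

theorem X_mul_expSubOneDiv :
    PowerSeries.X * expSubOneDiv = PowerSeries.exp ℚ - 1 := by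
  ext n
  cases n with
  | zero => simp [PowerSeries.coeff_zero_eq_constantCoeff]
  | succ n =>
    simp [expSubOneDiv, PowerSeries.coeff_succ_X_mul, PowerSeries.coeff_exp,
      PowerSeries.coeff_one]

theorem constantCoeff_expSubOneDiv : PowerSeries.constantCoeff expSubOneDiv = 1 := by
  simp [expSubOneDiv, ← PowerSeries.coeff_zero_eq_constantCoeff_apply]

/-- The power series `t / (e ^ t - 1)`. -/
noncomputable def bernoulliSeries : PowerSeries ℚ := expSubOneDiv⁻¹

theorem bernoulliSeries_mul : bernoulliSeries * (PowerSeries.exp ℚ - 1) = PowerSeries.X := by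
  rw [← X_mul_expSubOneDiv, bernoulliSeries, mul_left_comm, PowerSeries.inv_mul_cancel, mul_one]
  rw [constantCoeff_expSubOneDiv]
  exact one_ne_zero

/-- The power series `(t / (e ^ t - 1)) ^ l` for an integer `l` of either sign. -/
noncomputable def bernoulliSeriesPow : ℤ → PowerSeries ℚ
  | Int.ofNat m => bernoulliSeries ^ m
  | Int.negSucc m => (bernoulliSeries⁻¹) ^ (m + 1)

/-- The higher order Bernoulli polynomial `B_n^{(l)}(x)`: `n!` times the coefficient of `t ^ n` in
`(t / (e ^ t - 1)) ^ l * e ^ (t * x)`, a power series in `t` with coefficients in `ℚ[x]`. -/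
noncomputable def hoBernoulli (l : ℤ) (n : ℕ) : Polynomial ℚ :=
  (n.factorial : ℚ) • PowerSeries.coeff n
    (PowerSeries.map Polynomial.C (bernoulliSeriesPow l) *
      PowerSeries.rescale (Polynomial.X : Polynomial ℚ) (PowerSeries.exp (Polynomial ℚ)))

/-- The maximum pole of a rational polynomial at `p`: the exponent of the highest power of `p` in
the denominator of any coefficient. -/
def maxPole (p : ℕ) (f : Polynomial ℚ) : ℕ :=
  f.support.sup fun i => padicValNat p (f.coeff i).den

/-- The right-hand side `ν_p(n choose k) - M` of the almost minimum zero estimate for `S(n, k)`,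
where `M` is the maximum pole of `B_{n-k}^{(-k)}(x)`. -/
noncomputable def amzEstimate (p n k : ℕ) : ℤ :=
  (padicValNat p (n.choose k) : ℤ) - (maxPole p (hoBernoulli (-(k : ℤ)) (n - k)) : ℤ)

/-- `S(n, k)` is an almost minimum zero case: the almost minimum zero estimate is sharp. -/
def IsAMZC (p n k : ℕ) : Prop :=
  (padicValNat p (Nat.stirlingSecond n k) : ℤ) = amzEstimate p n k

end StirlingPole

/-! Write `k = r + (p - 1) * N` with `r = k'`. The coefficients of `Δ ^ k (X ^ n)` are the numbers
`(n choose m) * k! S(m, k)`, so one statement about this polynomial controls every coefficient of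
the Bernoulli polynomial, which is `(n choose i) * S(n - i, k) / (n choose k)`.

Give `p`, `Δ` and the step-`p` difference `Δ_p = (1 + Δ) ^ p - 1` the weights `p - 1`, `1`, `p`.
Then `Δ ^ p = Δ_p - p Δ` up to terms of larger weight, and repeated substitution gives `Δ ^ k = (-p)
^ N Δ ^ r` plus terms that contain `Δ_p` or have weight above `k` (`X_pow_sub_mem_weightSpan`). On
`X ^ n` the terms with `Δ_p` are divisible by `p ^ (N + 1)` (`pow_dvd_of_le_weight`, from Kummer's
theorem and a digit sum bound for `j! S(m, j)`); the others are divisible by `p ^ N`, and by `p ^ (N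
+ 1)` at `0` if `n ≡ r` modulo `p - 1`. So `p ^ N` divides all the coefficients, and in the
congruent case `k! S(n, k) ≡ (-p) ^ N r!` modulo `p ^ (N + 1)`, with `r!` prime to `p`.

By Legendre's formula, dividing by `k!` leaves the exponent `V = (σ_p(k) - r) / (p - 1)`. It is
attained at `m = n'`: `n'` is congruent to `r`, and `n choose n'` is prime to `p`. -/

namespace StirlingPole

/-! ### Digit sums, borrowing and segments -/

section Digits

variable {p : ℕ}

theorem digitSum_zero : digitSum p 0 = 0 := by simp [digitSum]

theorem digitSum_add_mul (hp : 1 < p) {r : ℕ} (hr : r < p) (q : ℕ) :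
    digitSum p (r + p * q) = r + digitSum p q := by
  by_cases h : r = 0 ∧ q = 0
  · simp [h.1, h.2, digitSum]
  · have h' : r ≠ 0 ∨ q ≠ 0 := by tauto
    simp [digitSum, Nat.digits_add p hp r q hr h']

theorem digitSum_of_lt (hp : 1 < p) {r : ℕ} (hr : r < p) : digitSum p r = r := by
  simpa [digitSum_zero] using digitSum_add_mul hp hr 0

theorem digitSum_add_pow_mul (hp : 1 < p) (b : ℕ) : ∀ {r : ℕ}, r < p ^ b → ∀ q : ℕ,
    digitSum p (r + p ^ b * q) = digitSum p r + digitSum p q := by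
  induction b with
  | zero =>
    intro r hr q
    have : r = 0 := by simpa using hr
    simp [this, digitSum_zero]
  | succ b ih =>
    intro r hr q
    have hlt : r % p < p := Nat.mod_lt _ (by omega)
    have hdiv : r / p < p ^ b := by
      apply Nat.div_lt_of_lt_mul
      rwa [pow_succ'] at hr
    have h1 : r + p ^ (b + 1) * q = r % p + p * (r / p + p ^ b * q) := by
      conv_lhs => rw [← Nat.mod_add_div r p]
      ring
    have h2 : digitSum p r = r % p + digitSum p (r / p) := by
      conv_lhs => rw [← Nat.mod_add_div r p]
      exact digitSum_add_mul hp hlt _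
    rw [h1, digitSum_add_mul hp hlt, ih hdiv, h2, add_assoc]

theorem digitSum_mod_add_div (hp : 1 < p) (n b : ℕ) :
    digitSum p n = digitSum p (n % p ^ b) + digitSum p (n / p ^ b) := by
  conv_lhs => rw [← Nat.mod_add_div n (p ^ b)]
  exact digitSum_add_pow_mul hp b (Nat.mod_lt _ (by positivity)) _

theorem digitSum_mul_pow (hp : 1 < p) (c h : ℕ) : digitSum p (c * p ^ h) = digitSum p c := by
  have := digitSum_add_pow_mul hp h (r := 0) (by positivity) c
  simpa [digitSum_zero, mul_comm] using this

theorem digitSum_sub_of_le_mod (hp : 1 < p) {n v : ℕ} (hv : v ≤ n % p) :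
    digitSum p (n - v) + v = digitSum p n := by
  have hlt : n % p < p := Nat.mod_lt _ (by omega)
  have hn := Nat.mod_add_div n p
  have h1 : n - v = (n % p - v) + p * (n / p) := by omega
  have h2 : digitSum p n = n % p + digitSum p (n / p) := by
    conv_lhs => rw [← hn]
    exact digitSum_add_mul hp hlt _
  rw [h1, digitSum_add_mul hp (by omega), h2]
  omega

theorem digitSum_le_self (n : ℕ) : digitSum p n ≤ n := Nat.digit_sum_le p n

theorem digitSum_pos (hp : 1 < p) {n : ℕ} (hn : 0 < n) : 0 < digitSum p n := by
  induction n using Nat.strong_induction_on with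
  | _ n ih =>
    have h2 : digitSum p n = n % p + digitSum p (n / p) := by
      conv_lhs => rw [← Nat.mod_add_div n p]
      exact digitSum_add_mul hp (Nat.mod_lt _ (by omega)) _
    rcases Nat.eq_zero_or_pos (n % p) with h | h
    · have hdiv : 0 < n / p :=
        Nat.div_pos (Nat.le_of_dvd hn (Nat.dvd_of_mod_eq_zero h)) (by omega)
      have := ih _ (Nat.div_lt_self hn hp) hdiv
      omega
    · omega

theorem modEq_digitSum (hp : 1 < p) (n : ℕ) : n ≡ digitSum p n [MOD (p - 1)] := by
  rcases Nat.lt_or_ge 2 p with h | h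
  · refine Nat.modEq_digits_sum (p - 1) p ?_ n
    obtain ⟨q, rfl⟩ : ∃ q, p = q + 1 := ⟨p - 1, by omega⟩
    simp only [Nat.add_sub_cancel, Nat.add_mod_left]
    exact Nat.mod_eq_of_lt (by omega)
  · obtain rfl : p = 2 := by omega
    exact Nat.modEq_one

theorem exists_eq_add_mul_of_modEq {d a r : ℕ} (hr : r ≤ d) (ha : 0 < a) (h : a ≡ r [MOD d]) :
    ∃ N, a = r + d * N := by
  have hle : r ≤ a := by
    by_contra! hlt
    have := (Nat.modEq_iff_dvd' hlt.le).1 h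
    have := Nat.le_of_dvd (by omega) this
    omega
  obtain ⟨N, hN⟩ := (Nat.modEq_iff_dvd' hle).1 h.symm
  exact ⟨N, by omega⟩

/-- The subtraction borrows exactly one unit from the nonzero last digit of `c`. -/
theorem digitSum_sub_add_one (hp : 1 < p) {c h m : ℕ} (hc : 1 ≤ digit p c 0) (hm : 1 ≤ m)
    (hmh : m < p ^ h) :
    digitSum p (c * p ^ h - m) + 1 = digitSum p (c * p ^ h) + digitSum p (p ^ h - m) := by
  have hc' : 1 ≤ c % p := by simpa [digit] using hc
  have hc1 : 1 ≤ c := hc'.trans (Nat.mod_le _ _)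
  have h1 : c * p ^ h - m = (p ^ h - m) + p ^ h * (c - 1) := by
    obtain ⟨d, rfl⟩ : ∃ d, c = d + 1 := ⟨c - 1, by omega⟩
    simp only [Nat.add_sub_cancel]
    have : (d + 1) * p ^ h = p ^ h * d + p ^ h := by ring
    omega
  rw [h1, digitSum_add_pow_mul hp h (by omega), digitSum_mul_pow hp,
    ← digitSum_sub_of_le_mod hp hc']
  ring

/-- Since `j ≤ r * p ^ (h - 1)`, the digit of `p ^ h - j` at place `h - 1` is at least `p - r`. If
`e > 0` the bound on `j` is strict, so that digit is larger or a lower one is nonzero; `min e 1`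
records this gain. -/
theorem le_digitSum_pow_sub (hp : 1 < p) {h j e r : ℕ} (hj : 1 ≤ j) (hr : r < p)
    (hle : p * j + e ≤ r * p ^ h) :
    p + min e 1 ≤ digitSum p (p ^ h - j) + r ∧ j < p ^ h := by
  have hh : h ≠ 0 := by
    rintro rfl
    nlinarith
  obtain ⟨g, rfl⟩ := Nat.exists_eq_succ_of_ne_zero hh
  have hP : 0 < p ^ g := by positivity
  have hle' : p * j + e ≤ p * (r * p ^ g) := by
    rw [Nat.succ_eq_add_one, pow_succ'] at hle
    linarith [hle, mul_left_comm r p (p ^ g)]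
  have hj1 : j + min e 1 ≤ r * p ^ g := by
    rcases Nat.eq_zero_or_pos e with rfl | he
    · simpa using Nat.le_of_mul_le_mul_left hle' (by omega)
    · have : j < r * p ^ g := Nat.lt_of_mul_lt_mul_left (a := p) (by omega)
      omega
  have hrp : (r + 1) * p ^ g ≤ p ^ (g + 1) := by
    rw [pow_succ']
    exact Nat.mul_le_mul_right _ hr
  have hrp' : (p - r) * p ^ g + r * p ^ g = p ^ (g + 1) := by
    rw [← add_mul, Nat.sub_add_cancel hr.le, pow_succ']
  have hjlt : j < p ^ (g + 1) := by nlinarith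
  refine ⟨?_, hjlt⟩
  set x := p ^ (g + 1) - j with hx
  have hxge : (p - r) * p ^ g + min e 1 ≤ x := by omega
  have hxlt : x < p * p ^ g := by rw [← pow_succ']; omega
  have hq : x / p ^ g < p := Nat.div_lt_of_lt_mul (by rwa [mul_comm])
  have hq' : p - r ≤ x / p ^ g := (Nat.le_div_iff_mul_le hP).2 (by omega)
  have hs := digitSum_mod_add_div hp x g
  rw [digitSum_of_lt hp hq] at hs
  rcases hq'.eq_or_lt with heq | hlt
  · have hd := Nat.mod_add_div x (p ^ g)
    rw [← heq, mul_comm] at hd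
    rcases Nat.eq_zero_or_pos e with rfl | he
    · simp only [Nat.zero_min]
      omega
    · have : 0 < digitSum p (x % p ^ g) := digitSum_pos hp (by omega)
      omega
  · omega

theorem sum_range_digit (n b : ℕ) :
    ∑ i ∈ Finset.range b, digit p n i * p ^ i = n % p ^ b := by
  induction b with
  | zero => simp [Nat.mod_one]
  | succ b ih => rw [Finset.sum_range_succ, ih, Nat.mod_pow_succ, digit, mul_comm (p ^ b)]

theorem digit_lt (hp : 1 < p) (n i : ℕ) : digit p n i < p := Nat.mod_lt _ (by omega)

theorem digitSum_mod_pow_succ (hp : 1 < p) (n b : ℕ) :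
    digitSum p (n % p ^ (b + 1)) = digitSum p (n % p ^ b) + digit p n b := by
  rw [Nat.mod_pow_succ, digitSum_add_pow_mul hp b (Nat.mod_lt _ (by positivity)),
    digitSum_of_lt hp (Nat.mod_lt _ (by omega)), digit]

theorem exists_digitSum_mod_add_eq (hp : 1 < p) {n r : ℕ} (hr : r ≤ digitSum p n) :
    ∃ b v, v ≤ digit p n b ∧ digitSum p (n % p ^ b) + v = r := by
  have key : ∀ B, r ≤ digitSum p (n % p ^ B) →
      ∃ b v, v ≤ digit p n b ∧ digitSum p (n % p ^ b) + v = r := by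
    intro B
    induction B with
    | zero =>
      intro h
      refine ⟨0, 0, Nat.zero_le _, ?_⟩
      simp only [pow_zero, Nat.mod_one, digitSum_zero] at h ⊢
      omega
    | succ B ih =>
      intro h
      by_cases h' : r ≤ digitSum p (n % p ^ B)
      · exact ih h'
      · rw [digitSum_mod_pow_succ hp] at h
        exact ⟨B, r - digitSum p (n % p ^ B), by omega, by omega⟩
  -- `n < p ^ n`, so reduction modulo `p ^ n` loses nothing.
  apply key n
  rwa [Nat.mod_eq_of_lt (Nat.lt_pow_self hp)]

theorem digit_sum_mul_pow (hp : 1 < p) {B : ℕ} : ∀ {f : ℕ → ℕ}, (∀ i, f i < p) → ∀ j,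
    digit p (∑ i ∈ Finset.range B, f i * p ^ i) j = if j < B then f j else 0 := by
  induction B with
  | zero => intro f _ j; simp [digit]
  | succ B ih =>
    intro f hf j
    have h1 : ∑ i ∈ Finset.range (B + 1), f i * p ^ i =
        f 0 + p * ∑ i ∈ Finset.range B, f (i + 1) * p ^ i := by
      rw [Finset.sum_range_succ', Finset.mul_sum, add_comm]
      simp only [pow_zero, mul_one]
      congr 1
      refine Finset.sum_congr rfl fun i _ => ?_
      ring
    rw [h1]
    cases j with
    | zero => simp [digit, Nat.mod_eq_of_lt (hf 0)]
    | succ j =>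
      have h2 := ih (f := fun i => f (i + 1)) (fun i => hf _) j
      simp only [add_lt_add_iff_right]
      rw [← h2, digit, digit, pow_succ', ← Nat.div_div_eq_div_mul,
        Nat.add_mul_div_left _ _ (by omega), Nat.div_eq_of_lt (hf 0), zero_add]

/-- Minimality among segments is proved from this digitwise domination alone. -/
theorem IsSegment.digit_le (hp : 1 < p) {n m : ℕ} (h : IsSegment p n m) (i : ℕ) :
    digit p m i ≤ digit p n i := by
  obtain ⟨a, b, u, v, hab, hu, hv, rfl⟩ := h
  let f : ℕ → ℕ := fun i => if i < a then 0 else if i = a then u else if i < b then digit p n i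
    else if i = b then v else 0
  have hfle : ∀ i, f i ≤ digit p n i := by
    intro i
    simp only [f]
    split_ifs <;> simp_all
  have hf : u * p ^ a + ∑ i ∈ Finset.Ioo a b, digit p n i * p ^ i + v * p ^ b =
      ∑ i ∈ Finset.range (b + 1), f i * p ^ i := by
    have h1 : ∑ i ∈ Finset.range a, f i * p ^ i = 0 := by
      refine Finset.sum_eq_zero fun i hi => ?_
      simp [f, Finset.mem_range.1 hi]
    have h2 : ∑ i ∈ Finset.Ioo a b, f i * p ^ i = ∑ i ∈ Finset.Ioo a b, digit p n i * p ^ i := by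
      refine Finset.sum_congr rfl fun i hi => ?_
      obtain ⟨h3, h4⟩ := Finset.mem_Ioo.1 hi
      simp [f, h3.not_gt, h3.ne', h4]
    have ha : f a = u := by simp [f]
    have hb : f b = v := by simp [f, hab.not_gt, hab.ne']
    rw [Finset.sum_range_succ, ← Finset.sum_range_add_sum_Ico _ hab.le, h1,
      ← Finset.Ioo_insert_left hab, Finset.sum_insert (by simp), h2, ha, hb]
    ring
  rw [hf, digit_sum_mul_pow hp (fun i => (hfle i).trans_lt (digit_lt hp n i))]
  split_ifs
  · exact hfle i
  · exact Nat.zero_le _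

theorem digitSum_mod_pow_le_of_digit_le (hp : 1 < p) {m n : ℕ}
    (h : ∀ i, digit p m i ≤ digit p n i) (b : ℕ) :
    digitSum p (m % p ^ b) ≤ digitSum p (n % p ^ b) ∧
      (digitSum p (n % p ^ b) ≤ digitSum p (m % p ^ b) → m % p ^ b = n % p ^ b) := by
  induction b with
  | zero => simp [Nat.mod_one]
  | succ b ih =>
    rw [digitSum_mod_pow_succ hp, digitSum_mod_pow_succ hp]
    have hb := h b
    refine ⟨by omega, fun hle => ?_⟩
    have h1 := ih.2 (by omega)
    have h2 : digit p m b = digit p n b := by omega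
    rw [Nat.mod_pow_succ, Nat.mod_pow_succ, h1]
    simp only [digit] at h2
    rw [h2]

/-- Filling the lowest places first is optimal: a digit sum missing below place `b` must be made up
above it, which makes `m / p ^ b` exceed `v`. Otherwise `m` and `n` agree below place `b`. -/
theorem le_of_digit_le_of_digitSum_eq (hp : 1 < p) {m n b v : ℕ}
    (h : ∀ i, digit p m i ≤ digit p n i)
    (hs : digitSum p m = digitSum p (n % p ^ b) + v) :
    n % p ^ b + p ^ b * v ≤ m := by
  obtain ⟨h1, h2⟩ := digitSum_mod_pow_le_of_digit_le hp h b
  rw [digitSum_mod_add_div hp m b] at hs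
  have hq : digitSum p (m / p ^ b) ≤ m / p ^ b := digitSum_le_self _
  have hm := Nat.mod_add_div m (p ^ b)
  have hlt : n % p ^ b < p ^ b := Nat.mod_lt _ (by positivity)
  rcases Nat.lt_or_ge v (m / p ^ b) with hv | hv
  · have : p ^ b * (v + 1) ≤ p ^ b * (m / p ^ b) := Nat.mul_le_mul_left _ hv
    have := Nat.mul_div_le m (p ^ b)
    linarith
  · have h3 := h2 (by omega)
    rw [h3] at hs
    have h4 : v = m / p ^ b := by omega
    rw [← h3, h4, hm]

theorem IsBottomSegment.isSegment {n m : ℕ} (h : IsBottomSegment p n m) : IsSegment p n m := by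
  obtain ⟨b, v, hv, rfl⟩ := h
  rcases Nat.eq_zero_or_pos b with rfl | hb
  · exact ⟨0, 1, v, 0, one_pos, hv, Nat.zero_le _, by
      simp [show Finset.Ioo 0 1 = ∅ from rfl]⟩
  · refine ⟨0, b, digit p n 0, v, hb, le_rfl, hv, ?_⟩
    rw [Finset.range_eq_Ico, ← Finset.Ioo_insert_left hb, Finset.sum_insert (by simp)]

theorem digitSum_mod_add_mul (hp : 1 < p) {n b v : ℕ} (hv : v ≤ digit p n b) :
    digitSum p (n % p ^ b + p ^ b * v) = digitSum p (n % p ^ b) + v := by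
  rw [digitSum_add_pow_mul hp b (Nat.mod_lt _ (by positivity)),
    digitSum_of_lt hp (hv.trans_lt (digit_lt hp n b))]

theorem digitSum_sub_add (hp : 1 < p) {n b v k : ℕ} (hv : v ≤ digit p n b)
    (hk : k ≤ n % p ^ b + p ^ b * v) :
    digitSum p (n - k) + digitSum p (n % p ^ b + p ^ b * v) =
      digitSum p n + digitSum p (n % p ^ b + p ^ b * v - k) := by
  have hP : 0 < p ^ b := by positivity
  rw [digitSum_mod_add_mul hp hv]
  set x := n % p ^ b + p ^ b * v - k with hx
  have hlt : n % p ^ b < p ^ b := Nat.mod_lt _ hP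
  have hxlt : x < p ^ b * (v + 1) := by
    rw [mul_add]; omega
  have hq : x / p ^ b ≤ v := Nat.lt_succ_iff.1 (Nat.div_lt_of_lt_mul hxlt)
  have hxd := Nat.mod_add_div x (p ^ b)
  have hv' : v ≤ n / p ^ b % p := hv
  have hvn : v ≤ n / p ^ b := hv'.trans (Nat.mod_le _ _)
  have hn := Nat.mod_add_div n (p ^ b)
  have hxs := digitSum_mod_add_div hp x b
  have hns := digitSum_mod_add_div hp n b
  generalize x / p ^ b = q at *
  generalize n / p ^ b = c at *
  -- Subtracting `k` from the bottom segment lowers its part at place `b` from `v` to `q`; in `n`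
  -- the digit at `b` drops by the same `v - q`, and no borrow passes beyond it.
  have hnk : n - k = x % p ^ b + p ^ b * (c - (v - q)) := by
    have h1 : p ^ b * (c - (v - q)) + p ^ b * v = p ^ b * c + p ^ b * q := by
      rw [← mul_add, ← mul_add]
      congr 1
      omega
    generalize x % p ^ b = y at *
    generalize n % p ^ b = z at *
    omega
  have h2 := digitSum_sub_of_le_mod hp (n := c) (v := v - q) (by omega)
  rw [hnk, digitSum_add_pow_mul hp b (Nat.mod_lt _ hP), hns, hxs,
    digitSum_of_lt hp (hq.trans_lt (hv.trans_lt (digit_lt hp n b)))]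
  omega

end Digits

/-! ### Finite differences, surjection numbers and their divisibility -/

section Differences

open Polynomial

/-- The number `j! S(m, j)` of surjections from an `m`-element set onto a `j`-element set. -/
def surjCount (m j : ℕ) : ℤ := (j.factorial : ℤ) * (Nat.stirlingSecond m j : ℤ)

/-- The Leibniz rule for multiplication by the variable; at `0` it turns into the Stirling
recurrence. -/
theorem fwdDiff_iter_id_mul (f : ℤ → ℤ) (j : ℕ) (x : ℤ) :
    (fwdDiff (1 : ℤ))^[j + 1] (fun y => y * f y) x =
      x * (fwdDiff (1 : ℤ))^[j + 1] f x + (j + 1) * (fwdDiff (1 : ℤ))^[j] f (x + 1) := by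
  induction j generalizing x with
  | zero => simp [fwdDiff]; ring
  | succ j ih =>
    rw [Function.iterate_succ_apply', fwdDiff, ih, ih, Function.iterate_succ_apply' _ (j + 1) f,
      fwdDiff, Function.iterate_succ_apply' _ j f, fwdDiff, fwdDiff]
    push_cast
    ring

theorem fwdDiff_iter_pow_zero (m j : ℕ) :
    (fwdDiff (1 : ℤ))^[j] (fun y : ℤ => y ^ m) 0 = surjCount m j := by
  induction m generalizing j with
  | zero =>
    cases j with
    | zero => simp [surjCount]
    | succ j =>
      have h : (fwdDiff (1 : ℤ))^[j + 1] (fun y : ℤ => y ^ 0) = 0 :=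
        fwdDiff_iter_pow_eq_zero_of_lt (Nat.succ_pos j)
      rw [h]
      simp [surjCount]
  | succ m ih =>
    cases j with
    | zero => simp [surjCount]
    | succ j =>
      have h := fwdDiff_iter_id_mul (fun y : ℤ => y ^ m) j 0
      have h1 : (fwdDiff (1 : ℤ))^[j] (fun y : ℤ => y ^ m) (0 + 1) =
          (fwdDiff (1 : ℤ))^[j + 1] (fun y : ℤ => y ^ m) 0 +
            (fwdDiff (1 : ℤ))^[j] (fun y : ℤ => y ^ m) 0 := by
        rw [Function.iterate_succ_apply', fwdDiff]
        ring
      rw [h1, ih, ih] at h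
      simp only [pow_succ', h, surjCount, Nat.stirlingSecond_succ_succ, Nat.factorial_succ]
      push_cast
      ring

theorem surjCount_eq_sum (m j : ℕ) : surjCount m j =
    ∑ i ∈ Finset.range (j + 1), ((-1 : ℤ) ^ (j - i) * j.choose i) * (i : ℤ) ^ m := by
  rw [← fwdDiff_iter_pow_zero, fwdDiff_iter_eq_sum_shift]
  simp

theorem surjCount_succ (m j : ℕ) :
    surjCount m (j + 1) = ∑ i ∈ Finset.range m, (m.choose i : ℤ) * surjCount i j := by
  have h : fwdDiff (1 : ℤ) (fun y : ℤ => y ^ m) =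
      ∑ i ∈ Finset.range m, (m.choose i : ℤ) • fun y : ℤ => y ^ i := by
    ext x
    simp [fwdDiff, add_pow, Finset.sum_range_succ, mul_comm]
  rw [← fwdDiff_iter_pow_zero, Function.iterate_succ_apply, h, fwdDiff_iter_finsetSum,
    Finset.sum_apply]
  refine Finset.sum_congr rfl fun i _ => ?_
  rw [fwdDiff_iter_const_smul, Pi.smul_apply, fwdDiff_iter_pow_zero, smul_eq_mul]

theorem surjCount_of_lt {m j : ℕ} (h : m < j) : surjCount m j = 0 := by
  simp [surjCount, Nat.stirlingSecond_eq_zero_of_lt h]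

theorem surjCount_self (m : ℕ) : surjCount m m = m.factorial := by
  simp [surjCount, Nat.stirlingSecond_self]

/-- `taylor h` is the shift by `h`, so `taylor h - 1` is the difference operator of step `h`. -/
theorem taylor_sub_one_pow_eq_fwdDiff (h : ℤ) (f : ℤ[X]) (j : ℕ) (y : ℤ) :
    taylor (h * y) (((taylor h - 1 : Module.End ℤ ℤ[X]) ^ j) f) =
      (fwdDiff (1 : ℤ))^[j] (fun i : ℤ => taylor (h * i) f) y := by
  induction j generalizing y with
  | zero => simp
  | succ j ih =>
    rw [Function.iterate_succ_apply', fwdDiff, ← ih, ← ih, pow_succ', Module.End.mul_apply,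
      LinearMap.sub_apply, map_sub, taylor_taylor, mul_add, mul_one]
    rfl

theorem coeff_taylor_sub_one_pow (h : ℤ) (n j d : ℕ) :
    (((taylor h - 1 : Module.End ℤ ℤ[X]) ^ j) (X ^ n)).coeff d =
      n.choose d * h ^ (n - d) * surjCount (n - d) j := by
  have h0 := taylor_sub_one_pow_eq_fwdDiff h (X ^ n) j 0
  rw [mul_zero, taylor_zero] at h0
  rw [h0, fwdDiff_iter_eq_sum_shift, finsetSum_coeff, surjCount_eq_sum, Finset.mul_sum]
  refine Finset.sum_congr rfl fun i _ => ?_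
  rw [coeff_smul, taylor_X_pow, coeff_X_add_C_pow]
  simp only [zero_add, smul_eq_mul, nsmul_eq_mul, mul_one, mul_pow]
  ring

theorem taylor_one_pow (p : ℕ) :
    (taylor 1 : Module.End ℤ ℤ[X]) ^ p = (taylor (p : ℤ) : Module.End ℤ ℤ[X]) := by
  induction p with
  | zero =>
    ext f
    simp
  | succ p ih =>
    refine LinearMap.ext fun f => ?_
    rw [pow_succ', ih, Module.End.mul_apply, taylor_taylor]
    push_cast
    rw [add_comm]

variable {p : ℕ}

theorem sub_one_mul_padicValNat_choose (hp : p.Prime) {n i : ℕ} (h : i ≤ n) :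
    (p - 1) * padicValNat p (n.choose i) + digitSum p n =
      digitSum p i + digitSum p (n - i) := by
  have := Fact.mk hp
  have h1 := sub_one_mul_padicValNat_factorial (p := p) n
  have h2 := sub_one_mul_padicValNat_factorial (p := p) i
  have h3 := sub_one_mul_padicValNat_factorial (p := p) (n - i)
  have h4 := Nat.choose_mul_factorial_mul_factorial h
  have h5 : padicValNat p (n.choose i) + padicValNat p i.factorial +
      padicValNat p (n - i).factorial = padicValNat p n.factorial := by
    rw [← h4, padicValNat.mul, padicValNat.mul]
    · exact (Nat.choose_pos h).ne'
    · exact Nat.factorial_ne_zero _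
    · exact mul_ne_zero (Nat.choose_pos h).ne' (Nat.factorial_ne_zero _)
    · exact Nat.factorial_ne_zero _
  rw [← h5, mul_add, mul_add] at h1
  have h6 : digitSum p n ≤ n := digitSum_le_self n
  have h7 : digitSum p i ≤ i := digitSum_le_self i
  have h8 : digitSum p (n - i) ≤ n - i := digitSum_le_self _
  simp only [digitSum] at *
  omega

theorem sub_one_mul_padicValNat_factorial_add (hp : p.Prime) (n : ℕ) :
    (p - 1) * padicValNat p n.factorial + digitSum p n = n := by
  have := Fact.mk hp
  have h1 := sub_one_mul_padicValNat_factorial (p := p) n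
  have h6 : digitSum p n ≤ n := digitSum_le_self n
  simp only [digitSum] at *
  omega

theorem pow_dvd_mul_of_pow_sub_dvd {a t : ℤ} {B v : ℕ} (ha : (p : ℤ) ^ v ∣ a)
    (ht : (p : ℤ) ^ (B - v) ∣ t) : (p : ℤ) ^ B ∣ a * t :=
  (pow_dvd_pow _ (by omega : B ≤ v + (B - v))).trans (pow_add (p : ℤ) v _ ▸ mul_dvd_mul ha ht)

theorem pow_padicValNat_dvd_int (n : ℕ) : (p : ℤ) ^ padicValNat p n ∣ (n : ℤ) := by
  exact_mod_cast pow_padicValNat_dvd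

/-- This is `ν_p(j! S(m, j)) ≥ (j - σ_p(m)) / (p - 1)`, rounded up. In the recursion over `i < m`,
Kummer's theorem trades `σ_p(m)` for `σ_p(i) + σ_p(m - i)`, and `σ_p(m - i) ≥ 1` pays for lowering
`j` by one. -/
theorem pow_dvd_surjCount (hp : p.Prime) {m j B : ℕ}
    (h : (p - 1) * B + digitSum p m < j + (p - 1)) : (p : ℤ) ^ B ∣ surjCount m j := by
  induction j generalizing m B with
  | zero =>
    have : B = 0 := by
      by_contra hB
      have := Nat.le_mul_of_pos_right (p - 1) (Nat.pos_of_ne_zero hB)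
      omega
    simp [this]
  | succ j ih =>
    rw [surjCount_succ]
    refine Finset.dvd_sum fun i hi => ?_
    have him := Finset.mem_range.1 hi
    have hk := sub_one_mul_padicValNat_choose hp him.le
    refine pow_dvd_mul_of_pow_sub_dvd (pow_padicValNat_dvd_int _) ?_
    have hs := digitSum_pos hp.one_lt (n := m - i) (by omega)
    generalize padicValNat p (m.choose i) = v at *
    rcases le_total B v with hBv | hBv
    · simp [Nat.sub_eq_zero_of_le hBv]
    · refine ih ?_
      obtain ⟨d, rfl⟩ := Nat.exists_eq_add_of_le hBv
      rw [mul_add] at h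
      rw [Nat.add_sub_cancel_left]
      omega

theorem pow_dvd_surjCount_of_le (m j : ℕ) :
    (p : ℤ) ^ padicValNat p j.factorial ∣ surjCount m j :=
  (pow_padicValNat_dvd_int _).trans (Dvd.intro _ rfl)

theorem int_pow_modEq_of_modEq (hp : p.Prime) {n k : ℕ} (hn : 0 < n) (hk : 0 < k)
    (h : n ≡ k [MOD (p - 1)]) (i : ℤ) : i ^ n ≡ i ^ k [ZMOD p] := by
  have := Fact.mk hp
  rw [← ZMod.intCast_eq_intCast_iff]
  push_cast
  by_cases hi : (i : ZMod p) = 0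
  · simp [hi, hn.ne', hk.ne']
  · wlog hnk : n ≤ k generalizing n k
    · exact (this hk hn h.symm (by omega)).symm
    obtain ⟨d, hd⟩ := (Nat.modEq_iff_dvd' hnk).1 h
    have : k = n + (p - 1) * d := by omega
    rw [this, pow_add, pow_mul, ZMod.pow_card_sub_one_eq_one hi, one_pow, mul_one]

theorem surjCount_modEq (hp : p.Prime) {n k : ℕ} (hn : 0 < n) (hk : 0 < k)
    (h : n ≡ k [MOD (p - 1)]) (j : ℕ) : surjCount n j ≡ surjCount k j [ZMOD p] := by
  rw [surjCount_eq_sum, surjCount_eq_sum]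
  exact Int.ModEq.sum fun i _ => (int_pow_modEq_of_modEq hp hn hk h i).mul_left _

end Differences

/-! ### Weighted reduction of powers of the difference operator -/

section Weights

open Polynomial

/-- With `X` in the role of the difference operator `Δ`, this stands for the difference operator
of step `p`. -/
noncomputable def stepDiff (p : ℕ) : ℤ[X] := (X + 1) ^ p - 1

/-- The generators `p ^ a * Δ ^ e * Δ_p ^ j` of degree at most `k` and of weight at least `k`, where
`p`, `Δ`, `Δ_p` have weights `p - 1`, `1`, `p`; for `j = 0` the weight has to exceed `k`. -/
def weightGenerators (p k : ℕ) : Set ℤ[X] :=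
  {f | ∃ a e j : ℕ, e < p ∧ p * j + e ≤ k ∧
    (1 ≤ j ∧ k ≤ (p - 1) * a + p * j + e ∨ j = 0 ∧ 1 ≤ e ∧ k < (p - 1) * a + e) ∧
    f = (p : ℤ[X]) ^ a * X ^ e * stepDiff p ^ j}

variable {p : ℕ}

theorem stepDiff_eq (hp : p.Prime) :
    X ^ p = stepDiff p - ∑ i ∈ Finset.Ico 1 p, (p.choose i / p) • ((p : ℤ[X]) * X ^ i) := by
  have h : ∀ i ∈ Finset.Ico 1 p,
      (p.choose i / p) • ((p : ℤ[X]) * X ^ i) = X ^ i * (p.choose i : ℤ[X]) := by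
    intro i hi
    obtain ⟨h1, h2⟩ := Finset.mem_Ico.1 hi
    have hd : p.choose i / p * p = p.choose i :=
      Nat.div_mul_cancel (hp.dvd_choose_self (by omega) h2)
    have hd' : (p.choose i : ℤ[X]) = ((p.choose i / p : ℕ) : ℤ[X]) * p := by
      rw [← Nat.cast_mul, hd]
    rw [nsmul_eq_mul, hd']
    ring
  rw [Finset.sum_congr rfl h, stepDiff, add_pow, Finset.sum_range_succ,
    Finset.range_eq_Ico, Finset.sum_eq_sum_Ico_succ_bot hp.pos]
  simp only [one_pow, mul_one, pow_zero, Nat.choose_zero_right, Nat.choose_self, Nat.cast_one,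
    zero_add]
  ring

/-- Only `e = p - 1` needs work: there `X ^ p` is replaced by `Δ_p`, of weight `p`, and by multiples
of `p * X ^ i` with `i ≥ 1`, of weight at least `p`. -/
theorem X_mul_mem_weightSpan (hp : p.Prime) {k : ℕ} {f : ℤ[X]}
    (hf : f ∈ Submodule.span ℤ (weightGenerators p k)) :
    X * f ∈ Submodule.span ℤ (weightGenerators p (k + 1)) := by
  have h2 := hp.two_le
  induction hf using Submodule.span_induction with
  | zero => simp
  | add f g _ _ hf hg => rw [mul_add]; exact add_mem hf hg
  | smul c f _ hf => rw [mul_smul_comm]; exact Submodule.smul_mem _ _ hf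
  | mem f hf =>
    obtain ⟨a, e, j, he, hdeg, hw, rfl⟩ := hf
    rcases Nat.lt_or_ge (e + 1) p with he' | he'
    · refine Submodule.subset_span ⟨a, e + 1, j, he', by omega, by omega, ?_⟩
      ring
    · have hep : X * ((p : ℤ[X]) ^ a * X ^ e * stepDiff p ^ j) =
          (p : ℤ[X]) ^ a * stepDiff p ^ j * X ^ p := by
        rw [show p = e + 1 by omega]
        ring
      rw [hep, stepDiff_eq hp, mul_sub, Finset.mul_sum]
      refine sub_mem (Submodule.subset_span ⟨a, 0, j + 1, hp.pos, ?_, Or.inl ⟨?_, ?_⟩, ?_⟩)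
        (sum_mem fun i hi => ?_)
      · rw [mul_add]; omega
      · omega
      · rw [mul_add]; omega
      · ring
      · obtain ⟨hi1, hi2⟩ := Finset.mem_Ico.1 hi
        rw [mul_smul_comm]
        refine nsmul_mem (Submodule.subset_span ?_) _
        refine ⟨a + 1, i, j, hi2, by omega, ?_, by ring⟩
        rw [mul_add]
        omega

/-- Multiplying by `X` raises `r` until it passes `p - 1`; then `X ^ p` yields `-p * X`, its only
term of weight `p` without `Δ_p`, so `r` returns to `1` and `N` grows by one. -/
theorem X_pow_sub_mem_weightSpan (hp : p.Prime) (k : ℕ) : ∀ {N r : ℕ}, 1 ≤ r → r < p →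
    k = r + (p - 1) * N →
    X ^ k - (-(p : ℤ[X])) ^ N * X ^ r ∈ Submodule.span ℤ (weightGenerators p k) := by
  have h2 := hp.two_le
  induction k with
  | zero => intro N r hr _ h; omega
  | succ k ih =>
    intro N r hr hrp h
    rcases hr.eq_or_lt with rfl | hr'
    · cases N with
      | zero =>
        have : k = 0 := by simpa using h
        simp [this]
      | succ N =>
        rw [mul_add] at h
        have h1 := X_mul_mem_weightSpan hp (ih (N := N) (r := p - 1) (by omega) (by omega)
          (by omega))
        have h3 : X ^ (k + 1) - (-(p : ℤ[X])) ^ (N + 1) * X ^ 1 =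
            X * (X ^ k - (-(p : ℤ[X])) ^ N * X ^ (p - 1)) +
              (-(p : ℤ[X])) ^ N * (X ^ p + (p : ℤ[X]) * X) := by
          have : (X ^ p : ℤ[X]) = X * X ^ (p - 1) := by
            rw [← pow_succ', Nat.sub_add_cancel hp.one_le]
          rw [this]
          ring
        rw [h3]
        refine add_mem h1 ?_
        have h4 : (X ^ p + (p : ℤ[X]) * X : ℤ[X]) = stepDiff p - ∑ i ∈ Finset.Ico 2 p,
            (p.choose i / p) • ((p : ℤ[X]) * X ^ i) := by
          rw [stepDiff_eq hp, Finset.sum_eq_sum_Ico_succ_bot hp.one_lt, Nat.choose_one_right,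
            Nat.div_self hp.pos]
          simp only [one_smul, pow_one]
          ring
        have h5 : (-(p : ℤ[X])) ^ N * (X ^ p + (p : ℤ[X]) * X) =
            ((-1) ^ N : ℤ) • ((p : ℤ[X]) ^ N * (X ^ p + (p : ℤ[X]) * X)) := by
          rw [neg_pow, zsmul_eq_mul]
          push_cast
          ring
        rw [h5]
        refine Submodule.smul_mem _ _ ?_
        rw [h4, mul_sub, Finset.mul_sum]
        refine sub_mem (Submodule.subset_span ⟨N, 0, 1, hp.pos, ?_, Or.inl ⟨le_rfl, ?_⟩, ?_⟩)
          (sum_mem fun i hi => ?_)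
        · generalize (p - 1) * N = q at *
          omega
        · omega
        · ring
        · obtain ⟨hi1, hi2⟩ := Finset.mem_Ico.1 hi
          rw [mul_smul_comm]
          refine nsmul_mem (Submodule.subset_span ?_) _
          refine ⟨N + 1, i, 0, hi2, by omega, Or.inr ⟨rfl, by omega, ?_⟩, by ring⟩
          rw [mul_add]
          omega
    · obtain ⟨r, rfl⟩ : ∃ q, r = q + 1 := ⟨r - 1, by omega⟩
      have h1 := X_mul_mem_weightSpan hp (ih (N := N) (r := r) (by omega) (by omega) (by omega))
      convert h1 using 1
      ring

/-- For `m ≥ p ^ h` the factor `p ^ m` suffices, as `(p - 1) * m ≥ r * p ^ h ≥ k > (p - 1) * N`. For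
smaller `m` the valuations of `p ^ (a + m)`, the binomial coefficient and the surjection number are
added. -/
theorem pow_dvd_of_le_weight (hp : p.Prime) {c h k r N a e j m : ℕ} (hr : 1 ≤ r) (hrp : r < p)
    (hk : k = r + (p - 1) * N) (hc : 1 ≤ digit p c 0) (hkr : k ≤ r * p ^ h) (hj : 1 ≤ j)
    (he : e < p) (hdeg : p * j + e ≤ k) (hw : k ≤ (p - 1) * a + p * j + e)
    (hmn : m ≤ c * p ^ h) (hjm : j ≤ m) :
    (p : ℤ) ^ (N + 1) ∣ (p : ℤ) ^ a * ((c * p ^ h).choose m * (p : ℤ) ^ m * surjCount m j) := by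
  have h2 := hp.two_le
  have hre : (p : ℤ) ^ a * ((c * p ^ h).choose m * (p : ℤ) ^ m * surjCount m j) =
      (p : ℤ) ^ (a + m) * ((c * p ^ h).choose m * surjCount m j) := by
    rw [pow_add]; ring
  rw [hre]
  refine pow_dvd_mul_of_pow_sub_dvd dvd_rfl ?_
  obtain ⟨P, rfl⟩ : ∃ P, p = P + 1 := ⟨p - 1, by omega⟩
  simp only [Nat.add_sub_cancel] at hk hw
  rcases Nat.lt_or_ge m ((P + 1) ^ h) with hm | hm
  · refine pow_dvd_mul_of_pow_sub_dvd (pow_padicValNat_dvd_int _) ?_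
    have h3 := sub_one_mul_padicValNat_choose hp hmn
    have h4 := digitSum_sub_add_one hp.one_lt hc (hj.trans hjm) hm
    have h5 := le_digitSum_pow_sub hp.one_lt hj hrp (hdeg.trans hkr)
    have h6 := digitSum_pos hp.one_lt (n := (P + 1) ^ h - m) (by omega)
    generalize padicValNat (P + 1) ((c * (P + 1) ^ h).choose m) = v at *
    rcases Nat.eq_zero_or_pos (N + 1 - (a + m) - v) with h0 | h0
    · simp [h0]
    · generalize hB : N + 1 - (a + m) - v = B at *
      have hN : N + 1 = a + m + v + B := by omega
      refine pow_dvd_surjCount hp ?_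
      simp only [Nat.add_sub_cancel] at *
      have h7 : P * N + P = P * a + P * m + P * v + P * B := by
        rw [← Nat.mul_succ, Nat.succ_eq_add_one, hN]; ring
      -- For `m = j` this is the digit estimate for `p ^ h - j`; for `m > j` the extra `p - 1` on
      -- the right already absorbs `e`.
      have h8 : P * j + e + 1 < P * m + r + digitSum (P + 1) ((P + 1) ^ h - m) := by
        rcases hjm.eq_or_lt with rfl | hlt
        · omega
        · have : P * (j + 1) ≤ P * m := Nat.mul_le_mul_left _ hlt
          rw [mul_add] at this
          omega
      rw [add_mul] at hw
      omega
  · refine Dvd.dvd.mul_left ((pow_dvd_pow _ ?_).trans (pow_dvd_surjCount_of_le m j)) _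
    have h3 := sub_one_mul_padicValNat_factorial_add hp j
    have h4 := digitSum_le_self (p := P + 1) j
    simp only [Nat.add_sub_cancel] at h3
    generalize padicValNat (P + 1) j.factorial = u at *
    by_contra! hlt
    have h5 : P * (a + m + u) ≤ P * N := Nat.mul_le_mul_left _ (by omega)
    have h6 : r * (P + 1) ^ h ≤ P * m := Nat.mul_le_mul (by omega) hm
    rw [mul_add, mul_add] at h5
    omega

theorem C_dvd_map (c : ℤ) (T : ℤ[X] →ₗ[ℤ] ℤ[X]) {f : ℤ[X]} (h : C c ∣ f) : C c ∣ T f := by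
  obtain ⟨g, rfl⟩ := h
  refine ⟨T g, ?_⟩
  rw [← smul_eq_C_mul, ← smul_eq_C_mul, map_smul]

/-- The operators on `ℤ[X]` that are polynomials in the difference operator, applied to `X ^ n`. -/
noncomputable def diffPowX (n : ℕ) : ℤ[X] →ₗ[ℤ] ℤ[X] :=
  LinearMap.applyₗ (X ^ n : ℤ[X]) ∘ₗ
    (aeval (taylor 1 - 1 : Module.End ℤ ℤ[X])).toLinearMap

theorem diffPowX_apply (n : ℕ) (f : ℤ[X]) :
    diffPowX n f = aeval (taylor 1 - 1 : Module.End ℤ ℤ[X]) f (X ^ n) := rfl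

theorem diffPowX_generator (n a e j : ℕ) :
    diffPowX n ((p : ℤ[X]) ^ a * X ^ e * stepDiff p ^ j) =
      ((taylor 1 - 1 : Module.End ℤ ℤ[X]) ^ e)
        ((p : ℤ) ^ a • ((taylor (p : ℤ) - 1 : Module.End ℤ ℤ[X]) ^ j) (X ^ n)) := by
  have h : (p : ℤ[X]) ^ a * X ^ e * stepDiff p ^ j =
      X ^ e * (((p : ℤ) ^ a) • stepDiff p ^ j) := by
    rw [zsmul_eq_mul]
    push_cast
    ring
  have hw : aeval (taylor 1 - 1 : Module.End ℤ ℤ[X]) (stepDiff p) =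
      (taylor (p : ℤ) - 1 : Module.End ℤ ℤ[X]) := by
    simp [stepDiff, taylor_one_pow]
  have hX : aeval (taylor 1 - 1 : Module.End ℤ ℤ[X]) (X ^ e : ℤ[X]) =
      (taylor 1 - 1 : Module.End ℤ ℤ[X]) ^ e := by simp
  have hj : aeval (taylor 1 - 1 : Module.End ℤ ℤ[X]) (stepDiff p ^ j) =
      (taylor (p : ℤ) - 1 : Module.End ℤ ℤ[X]) ^ j := by rw [← hw, map_pow]
  rw [diffPowX_apply, h, map_mul, map_smul, hX, hj, Module.End.mul_apply, LinearMap.smul_apply]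

theorem coeff_diffPowX_X_pow (n k d : ℕ) :
    (diffPowX n (X ^ k)).coeff d = n.choose d * surjCount (n - d) k := by
  have hX : aeval (taylor 1 - 1 : Module.End ℤ ℤ[X]) (X ^ k : ℤ[X]) =
      (taylor 1 - 1 : Module.End ℤ ℤ[X]) ^ k := by simp
  rw [diffPowX_apply, hX, coeff_taylor_sub_one_pow]
  simp

theorem diffPowX_neg_pow_mul (n N r : ℕ) :
    diffPowX n ((-(p : ℤ[X])) ^ N * X ^ r) = C ((-(p : ℤ)) ^ N) * diffPowX n (X ^ r) := by
  rw [← smul_eq_C_mul, ← map_smul, zsmul_eq_mul]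
  push_cast
  rfl

/-- Elements of the weight span take `X ^ n` to a multiple of `p ^ N`, whose value at `0` is even a
multiple of `p ^ (N + 1)` if `n ≡ r` modulo `p - 1`. -/
theorem dvd_diffPowX_of_mem (hp : p.Prime) {c h k r N : ℕ} (hr : 1 ≤ r) (hrp : r < p)
    (hk : k = r + (p - 1) * N) (hc : 1 ≤ digit p c 0) (hkr : k ≤ r * p ^ h) {f : ℤ[X]}
    (hf : f ∈ Submodule.span ℤ (weightGenerators p k)) :
    C ((p : ℤ) ^ N) ∣ diffPowX (c * p ^ h) f ∧
      (c * p ^ h ≡ r [MOD (p - 1)] → (p : ℤ) ^ (N + 1) ∣ (diffPowX (c * p ^ h) f).coeff 0) := by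
  induction hf using Submodule.span_induction with
  | zero => simp
  | add f g _ _ hf hg =>
    rw [map_add, coeff_add]
    exact ⟨dvd_add hf.1 hg.1, fun h => dvd_add (hf.2 h) (hg.2 h)⟩
  | smul s f _ hf =>
    rw [map_smul, coeff_smul, smul_eq_C_mul, smul_eq_mul]
    exact ⟨hf.1.mul_left _, fun h => (hf.2 h).mul_left _⟩
  | mem f hf =>
    obtain ⟨a, e, j, he, hdeg, hw, rfl⟩ := hf
    rw [diffPowX_generator]
    rcases hw with ⟨hj, hw⟩ | ⟨rfl, he1, hw⟩
    · have key : C ((p : ℤ) ^ (N + 1)) ∣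
          (p : ℤ) ^ a • ((taylor (p : ℤ) - 1 : Module.End ℤ ℤ[X]) ^ j) (X ^ (c * p ^ h)) := by
        rw [C_dvd_iff_dvd_coeff]
        intro d
        rw [coeff_smul, coeff_taylor_sub_one_pow, smul_eq_mul]
        rcases Nat.lt_or_ge (c * p ^ h) d with hd | hd
        · simp [Nat.choose_eq_zero_of_lt hd]
        · rcases Nat.lt_or_ge (c * p ^ h - d) j with hdj | hdj
          · simp [surjCount_of_lt hdj]
          · rw [← Nat.choose_symm hd]
            exact pow_dvd_of_le_weight hp hr hrp hk hc hkr hj he hdeg hw (Nat.sub_le _ _) hdj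
      have key' := C_dvd_map _ ((taylor 1 - 1 : Module.End ℤ ℤ[X]) ^ e) key
      refine ⟨dvd_trans ?_ key', fun _ => (C_dvd_iff_dvd_coeff _ _).1 key' 0⟩
      exact _root_.map_dvd C (pow_dvd_pow _ (Nat.le_succ N))
    · have haN : N ≤ a := by
        by_contra! hlt
        have := Nat.mul_le_mul_left (p - 1) (Nat.succ_le_of_lt hlt)
        rw [Nat.succ_eq_add_one, mul_add] at this
        omega
      rw [pow_zero, Module.End.one_apply, map_smul]
      refine ⟨?_, fun hmod => ?_⟩
      · rw [smul_eq_C_mul]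
        exact (_root_.map_dvd C (pow_dvd_pow _ haN)).mul_right _
      · rw [coeff_smul, smul_eq_mul, coeff_taylor_sub_one_pow, Nat.choose_zero_right, one_pow,
          Nat.cast_one, one_mul, one_mul, Nat.sub_zero]
        -- If `a = N`, the strict weight condition forces `e > r`, and the missing factor `p` comes
        -- from `surjCount n e ≡ surjCount r e = 0`.
        rcases haN.eq_or_lt with rfl | hlt
        · rw [pow_succ]
          refine mul_dvd_mul_left _ ?_
          have hn : 0 < c * p ^ h := by
            refine Nat.mul_pos (Nat.pos_of_ne_zero ?_) (pow_pos hp.pos _)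
            rintro rfl
            simp [digit] at hc
          have := surjCount_modEq hp hn hr hmod e
          rw [surjCount_of_lt (by omega : r < e)] at this
          exact Int.modEq_zero_iff_dvd.1 this
        · exact (pow_dvd_pow _ hlt).mul_right _

theorem pow_dvd_choose_mul_surjCount (hp : p.Prime) {c h k r N m : ℕ} (hr : 1 ≤ r) (hrp : r < p)
    (hk : k = r + (p - 1) * N) (hc : 1 ≤ digit p c 0) (hkr : k ≤ r * p ^ h) (hm : m ≤ c * p ^ h) :
    (p : ℤ) ^ N ∣ (c * p ^ h).choose m * surjCount m k := by
  have h1 := (dvd_diffPowX_of_mem hp hr hrp hk hc hkr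
    (X_pow_sub_mem_weightSpan hp k hr hrp hk)).1
  rw [map_sub] at h1
  have h2 : C ((p : ℤ) ^ N) ∣ diffPowX (c * p ^ h) ((-(p : ℤ[X])) ^ N * X ^ r) := by
    rw [diffPowX_neg_pow_mul]
    exact (_root_.map_dvd C (pow_dvd_pow_of_dvd (dvd_neg.2 dvd_rfl) N)).mul_right _
  have h3 := (C_dvd_iff_dvd_coeff _ _).1 ((dvd_sub_left h2).1 h1) (c * p ^ h - m)
  rwa [coeff_diffPowX_X_pow, Nat.choose_symm hm, Nat.sub_sub_self hm] at h3

theorem not_pow_succ_dvd_surjCount (hp : p.Prime) {c h k r N : ℕ} (hr : 1 ≤ r) (hrp : r < p)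
    (hk : k = r + (p - 1) * N) (hc : 1 ≤ digit p c 0) (hkr : k ≤ r * p ^ h)
    (hmod : c * p ^ h ≡ r [MOD (p - 1)]) :
    ¬ (p : ℤ) ^ (N + 1) ∣ surjCount (c * p ^ h) k := by
  intro hdvd
  have h1 := (dvd_diffPowX_of_mem hp hr hrp hk hc hkr
    (X_pow_sub_mem_weightSpan hp k hr hrp hk)).2 hmod
  have hn : 0 < c * p ^ h := by
    refine Nat.mul_pos (Nat.pos_of_ne_zero ?_) (pow_pos hp.pos _)
    rintro rfl
    simp [digit] at hc
  rw [map_sub, diffPowX_neg_pow_mul, coeff_sub, coeff_C_mul, coeff_diffPowX_X_pow,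
    coeff_diffPowX_X_pow, Nat.choose_zero_right, Nat.cast_one, one_mul, one_mul, Nat.sub_zero,
    dvd_sub_right hdvd, neg_pow, mul_assoc, (Int.isUnit_iff.2 (neg_one_pow_eq_or ℤ N)).dvd_mul_left,
    pow_succ, mul_dvd_mul_iff_left (pow_ne_zero _ (Int.natCast_ne_zero.2 hp.ne_zero)),
    (surjCount_modEq hp hn hr hmod r).dvd_iff, surjCount_self, Int.natCast_dvd_natCast,
    hp.dvd_factorial] at h1
  omega

end Weights

/-! ### Coefficients and maximum pole of the Bernoulli polynomials -/

section Bernoulli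

open Polynomial

theorem coeff_exp_sub_one_pow (m k : ℕ) :
    PowerSeries.coeff m ((PowerSeries.exp ℚ - 1) ^ k) = (surjCount m k : ℚ) / m.factorial := by
  rw [sub_eq_add_neg, add_pow, map_sum, surjCount_eq_sum, Int.cast_sum, Finset.sum_div]
  refine Finset.sum_congr rfl fun i _ => ?_
  have h : PowerSeries.exp ℚ ^ i * (-1) ^ (k - i) * ((k.choose i : ℕ) : PowerSeries ℚ) =
      PowerSeries.C ((-1 : ℚ) ^ (k - i) * k.choose i) * PowerSeries.exp ℚ ^ i := by
    simp only [map_mul, map_pow, map_neg, map_one, map_natCast]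
    ring
  rw [h, PowerSeries.coeff_C_mul, PowerSeries.exp_pow_eq_rescale_exp, PowerSeries.coeff_rescale,
    PowerSeries.coeff_exp]
  push_cast
  simp
  ring

theorem coeff_expSubOneDiv_pow (a k : ℕ) :
    PowerSeries.coeff a (expSubOneDiv ^ k) = (surjCount (a + k) k : ℚ) / (a + k).factorial := by
  rw [← coeff_exp_sub_one_pow, ← X_mul_expSubOneDiv, mul_pow, PowerSeries.coeff_X_pow_mul]

theorem bernoulliSeriesPow_neg {k : ℕ} (hk : 0 < k) :
    bernoulliSeriesPow (-(k : ℤ)) = expSubOneDiv ^ k := by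
  obtain ⟨k, rfl⟩ := Nat.exists_eq_succ_of_ne_zero hk.ne'
  have h : expSubOneDiv⁻¹ * expSubOneDiv = 1 :=
    PowerSeries.inv_mul_cancel _ (by simp [constantCoeff_expSubOneDiv])
  have h1 : bernoulliSeries⁻¹ = expSubOneDiv := by
    rw [bernoulliSeries, PowerSeries.inv_eq_iff_mul_eq_one, mul_comm, h]
    simp [constantCoeff_expSubOneDiv]
  change (bernoulliSeries⁻¹) ^ (k + 1) = _
  rw [h1]

theorem coeff_hoBernoulli {n k : ℕ} (hk : 0 < k) (hkn : k ≤ n) (i : ℕ) :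
    (hoBernoulli (-(k : ℤ)) (n - k)).coeff i =
      ((n.choose i * Nat.stirlingSecond (n - i) k : ℕ) : ℚ) / (n.choose k : ℕ) := by
  have h1 : ∀ a b : ℕ, (PowerSeries.coeff a (PowerSeries.map Polynomial.C (expSubOneDiv ^ k)) *
      PowerSeries.coeff b (PowerSeries.rescale (X : ℚ[X]) (PowerSeries.exp ℚ[X]))).coeff i =
      if b = i then (surjCount (a + k) k : ℚ) / (a + k).factorial * (1 / b.factorial) else 0 := by
    intro a b
    rw [PowerSeries.coeff_map, PowerSeries.coeff_rescale, PowerSeries.coeff_exp, coeff_C_mul,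
      coeff_expSubOneDiv_pow, ← Polynomial.C_eq_algebraMap, mul_comm (X ^ b), coeff_C_mul_X_pow]
    by_cases h : b = i
    · simp [h]
    · simp [h, Ne.symm h]
  rw [hoBernoulli, bernoulliSeriesPow_neg hk, coeff_smul, PowerSeries.coeff_mul,
    finsetSum_coeff, Finset.sum_congr rfl fun x _ => h1 x.1 x.2, smul_eq_mul]
  rcases Nat.lt_or_ge (n - k) i with hi | hi
  · rw [Finset.sum_eq_zero, Nat.stirlingSecond_eq_zero_of_lt (by omega : n - i < k)]
    · simp
    · intro x hx
      have := Finset.HasAntidiagonal.mem_antidiagonal.1 hx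
      rw [if_neg (by omega)]
  · rw [Finset.sum_eq_single (n - k - i, i)]
    · have hin : i ≤ n := by omega
      simp only [if_true]
      rw [show n - k - i + k = n - i by omega, Nat.cast_mul, Nat.cast_choose ℚ hin,
        Nat.cast_choose ℚ hkn, surjCount]
      have f1 : (n.factorial : ℚ) ≠ 0 := Nat.cast_ne_zero.2 (Nat.factorial_ne_zero _)
      have f2 : (k.factorial : ℚ) ≠ 0 := Nat.cast_ne_zero.2 (Nat.factorial_ne_zero _)
      have f3 : (i.factorial : ℚ) ≠ 0 := Nat.cast_ne_zero.2 (Nat.factorial_ne_zero _)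
      have f4 : ((n - i).factorial : ℚ) ≠ 0 := Nat.cast_ne_zero.2 (Nat.factorial_ne_zero _)
      have f5 : ((n - k).factorial : ℚ) ≠ 0 := Nat.cast_ne_zero.2 (Nat.factorial_ne_zero _)
      push_cast
      field_simp
    · rintro ⟨a, b⟩ hx hne
      have := Finset.HasAntidiagonal.mem_antidiagonal.1 hx
      rw [if_neg]
      rintro rfl
      apply hne
      simp only [Prod.mk.injEq, and_true]
      simp only at this
      omega
    · intro h
      exact absurd (Finset.HasAntidiagonal.mem_antidiagonal.2 (by omega)) h

variable {p : ℕ}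

theorem padicValNat_den_div (hp : p.Prime) {a b : ℕ} (ha : a ≠ 0) (hb : b ≠ 0) :
    padicValNat p ((a : ℚ) / b).den = padicValNat p b - padicValNat p a := by
  have := Fact.mk hp
  have h1 := padicValRat.div (p := p) (q := (a : ℚ)) (r := b) (Nat.cast_ne_zero.2 ha)
    (Nat.cast_ne_zero.2 hb)
  rw [padicValRat.of_nat, padicValRat.of_nat, padicValRat_def] at h1
  -- In lowest terms `p` divides at most one of the two, which is why truncated subtraction is
  -- right.
  have h2 : padicValNat p ((a : ℚ) / b).den = 0 ∨ padicValInt p ((a : ℚ) / b).num = 0 := by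
    by_contra! h
    have h3 : p ∣ ((a : ℚ) / b).den := dvd_of_one_le_padicValNat (by omega)
    have h4 : p ∣ ((a : ℚ) / b).num.natAbs := dvd_of_one_le_padicValNat (by
      have := h.2
      rw [padicValInt] at this
      omega)
    exact Nat.not_coprime_of_dvd_of_dvd hp.one_lt h4 h3 ((a : ℚ) / b).reduced
  omega

theorem maxPole_eq {f : ℚ[X]} {D : ℕ}
    (hle : ∀ i, f.coeff i ≠ 0 → padicValNat p (f.coeff i).den ≤ D)
    (hex : ∃ i, f.coeff i ≠ 0 ∧ padicValNat p (f.coeff i).den = D) : maxPole p f = D := by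
  refine le_antisymm (Finset.sup_le fun i hi => hle i (mem_support_iff.1 hi)) ?_
  obtain ⟨i, hi, rfl⟩ := hex
  exact Finset.le_sup (f := fun i => padicValNat p (f.coeff i).den) (mem_support_iff.2 hi)

/-- The maximum pole of `B_{n-k}^{(-k)}(x)` in terms of the least valuation of the numbers
`(n choose j) * S(j, k)`. -/
theorem maxPole_hoBernoulli_eq (hp : p.Prime) {n k V j : ℕ} (hk : 0 < k) (hkn : k ≤ n)
    (hdvd : ∀ m ≤ n, p ^ V ∣ n.choose m * Nat.stirlingSecond m k)
    (hj : j ≤ n) (hndvd : ¬ p ^ (V + 1) ∣ n.choose j * Nat.stirlingSecond j k) :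
    V ≤ padicValNat p (n.choose k) ∧
      maxPole p (hoBernoulli (-(k : ℤ)) (n - k)) = padicValNat p (n.choose k) - V := by
  have := Fact.mk hp
  have hck : n.choose k ≠ 0 := (Nat.choose_pos hkn).ne'
  have hV : V ≤ padicValNat p (n.choose k) := by
    have := hdvd k hkn
    rwa [Nat.stirlingSecond_self, mul_one, padicValNat_dvd_iff_le hck] at this
  refine ⟨hV, maxPole_eq (fun i hi => ?_) ⟨n - j, ?_⟩⟩
  · rw [coeff_hoBernoulli hk hkn] at hi ⊢
    have h0 : n.choose i * Nat.stirlingSecond (n - i) k ≠ 0 := by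
      intro h
      simp [h] at hi
    have hin : i ≤ n := by
      by_contra! h
      simp [Nat.choose_eq_zero_of_lt h] at h0
    have := hdvd (n - i) (Nat.sub_le _ _)
    rw [Nat.choose_symm hin, padicValNat_dvd_iff_le h0] at this
    rw [padicValNat_den_div hp h0 hck]
    omega
  · have h0 : n.choose j * Nat.stirlingSecond j k ≠ 0 := by
      intro h
      simp [h] at hndvd
    rw [coeff_hoBernoulli hk hkn, Nat.sub_sub_self hj, Nat.choose_symm hj,
      padicValNat_den_div hp h0 hck]
    refine ⟨div_ne_zero (Nat.cast_ne_zero.2 h0) (Nat.cast_ne_zero.2 hck), ?_⟩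
    have := hdvd j hj
    rw [padicValNat_dvd_iff_le h0] at this hndvd
    omega

end Bernoulli

/-! ### Passage to Stirling numbers and the smallest segment -/

section Valuation

variable {p : ℕ}

theorem stirlingSecond_pos : ∀ {n k : ℕ}, 0 < k → k ≤ n → 0 < Nat.stirlingSecond n k
  | 0, k, hk, hkn => by omega
  | n + 1, 0, hk, _ => by omega
  | n + 1, 1, _, _ => by rw [Nat.stirlingSecond_one_right]; exact one_pos
  | n + 1, k + 2, _, hkn => by
    have := stirlingSecond_pos (n := n) (k := k + 1) (by omega) (by omega)
    rw [Nat.stirlingSecond_succ_succ]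
    omega

theorem pow_factorial_add_dvd_iff (hp : p.Prime) (k V A : ℕ) :
    p ^ (padicValNat p k.factorial + V) ∣ k.factorial * A ↔ p ^ V ∣ A := by
  have := Fact.mk hp
  rcases Nat.eq_zero_or_pos A with rfl | hA
  · simp
  · have hk := Nat.factorial_ne_zero k
    rw [padicValNat_dvd_iff_le (mul_ne_zero hk hA.ne'), padicValNat_dvd_iff_le hA.ne',
      padicValNat.mul hk hA.ne']
    omega

/-- `(σ_p(k) - r) / (p - 1)` is a natural number `V` which differs from `(k - r) / (p - 1)` by the
valuation of `k!`. -/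
theorem exists_digitSum_eq (hp : p.Prime) {k r : ℕ} (hr : r < p) (hk : 0 < k)
    (h : k ≡ r [MOD (p - 1)]) :
    ∃ V, digitSum p k = r + (p - 1) * V ∧
      k = r + (p - 1) * (padicValNat p k.factorial + V) := by
  obtain ⟨V, hV⟩ := exists_eq_add_mul_of_modEq (by omega) (digitSum_pos hp.one_lt hk)
    ((modEq_digitSum hp.one_lt k).symm.trans h)
  have h1 := sub_one_mul_padicValNat_factorial_add hp k
  refine ⟨V, hV, ?_⟩
  rw [mul_add]
  omega

theorem pow_dvd_choose_mul_stirlingSecond (hp : p.Prime) {c h k r V m : ℕ} (hr : 1 ≤ r)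
    (hrp : r < p) (hk : k = r + (p - 1) * (padicValNat p k.factorial + V))
    (hc : 1 ≤ digit p c 0) (hkr : k ≤ r * p ^ h) (hm : m ≤ c * p ^ h) :
    p ^ V ∣ (c * p ^ h).choose m * Nat.stirlingSecond m k := by
  have h1 := pow_dvd_choose_mul_surjCount hp hr hrp hk hc hkr hm
  rw [surjCount, mul_left_comm] at h1
  exact (pow_factorial_add_dvd_iff hp k V _).1 (by exact_mod_cast h1)

theorem not_pow_succ_dvd_stirlingSecond (hp : p.Prime) {c h k r V : ℕ} (hr : 1 ≤ r)
    (hrp : r < p) (hk : k = r + (p - 1) * (padicValNat p k.factorial + V))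
    (hc : 1 ≤ digit p c 0) (hkr : k ≤ r * p ^ h) (hmod : c * p ^ h ≡ r [MOD (p - 1)]) :
    ¬ p ^ (V + 1) ∣ Nat.stirlingSecond (c * p ^ h) k := by
  have h1 := not_pow_succ_dvd_surjCount hp hr hrp hk hc hkr hmod
  rw [surjCount, add_assoc] at h1
  rw [← pow_factorial_add_dvd_iff hp k]
  exact_mod_cast h1

/-- The smallest segment of `c * p ^ h` with digit sum `r`. -/
theorem exists_bottomSegment_mul_pow (hp : p.Prime) {c h r : ℕ} (hrp : r < p)
    (hs : r ≤ digitSum p (c * p ^ h)) :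
    ∃ c', IsBottomSegment p (c * p ^ h) (c' * p ^ h) ∧
      IsLeast {m : ℕ | IsSegment p (c * p ^ h) m ∧ digitSum p m = r} (c' * p ^ h) ∧
      min (digit p c 0) r ≤ digit p c' 0 ∧ c' * p ^ h ≤ c * p ^ h ∧
      ∀ k ≤ c' * p ^ h, digitSum p (c * p ^ h - k) + r =
        digitSum p (c * p ^ h) + digitSum p (c' * p ^ h - k) := by
  have h1 := hp.one_lt
  rw [digitSum_mul_pow h1] at hs
  obtain ⟨b, v, hv, hsum⟩ := exists_digitSum_mod_add_eq h1 hs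
  have hP : 0 < p ^ h := pow_pos hp.pos h
  have hdig : digit p (c * p ^ h) (b + h) = digit p c b := by
    rw [digit, digit, add_comm, pow_add, ← Nat.div_div_eq_div_mul, Nat.mul_div_cancel _ hP]
  have hmod : c * p ^ h % p ^ (b + h) = c % p ^ b * p ^ h := by
    rw [pow_add, Nat.mul_mod_mul_right]
  have hseg : (c % p ^ b + p ^ b * v) * p ^ h =
      c * p ^ h % p ^ (b + h) + p ^ (b + h) * v := by
    rw [hmod, pow_add]; ring
  have hv' : v ≤ digit p (c * p ^ h) (b + h) := hdig ▸ hv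
  have hbot : IsBottomSegment p (c * p ^ h) ((c % p ^ b + p ^ b * v) * p ^ h) := by
    refine ⟨b + h, v, hv', ?_⟩
    rw [sum_range_digit, hseg, mul_comm v]
  have hσ : digitSum p (c * p ^ h % p ^ (b + h)) + v = r := by
    rw [hmod, digitSum_mul_pow h1, hsum]
  have hσ' : digitSum p ((c % p ^ b + p ^ b * v) * p ^ h) = r := by
    rw [hseg, digitSum_mod_add_mul h1 hv', hσ]
  refine ⟨c % p ^ b + p ^ b * v, hbot, ⟨⟨hbot.isSegment, hσ'⟩, ?_⟩, ?_, ?_, ?_⟩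
  · rintro m ⟨hm, hmr⟩
    rw [hseg]
    exact le_of_digit_le_of_digitSum_eq h1 (hm.digit_le h1) (hmr.trans hσ.symm)
  -- The last digit of `c'` is that of `c` unless the segment stops at place `0`, where it is `r`.
  -- This lower bound lets `c'` replace `c` in the hypotheses on `k`.
  · rcases Nat.eq_zero_or_pos b with rfl | hb
    · simp only [pow_zero, Nat.mod_one, digitSum_zero, zero_add, one_mul] at hsum ⊢
      rw [hsum]
      simp [digit, Nat.mod_eq_of_lt hrp]
    · have hpb : p ∣ p ^ b := dvd_pow_self p hb.ne'
      have : digit p (c % p ^ b + p ^ b * v) 0 = digit p c 0 := by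
        simp only [digit, pow_zero, Nat.div_one]
        rw [Nat.add_mod, Nat.mod_eq_zero_of_dvd (hpb.mul_right v), add_zero, Nat.mod_mod,
          Nat.mod_mod_of_dvd _ hpb]
      rw [this]
      exact min_le_left _ _
  · refine Nat.mul_le_mul_right _ ?_
    have h2 : p ^ b * v ≤ p ^ b * (c / p ^ b) :=
      Nat.mul_le_mul_left _ (hv.trans (Nat.mod_le _ _))
    have := Nat.mod_add_div c (p ^ b)
    linarith
  · intro k hk
    have h2 := digitSum_sub_add h1 hv' (hseg ▸ hk)
    rwa [← hseg, hσ'] at h2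

end Valuation

end StirlingPole

theorem mainTheorem2 (p : ℕ) (hp : p.Prime) (c h n k k' : ℕ) (hn : n = c * p ^ h)
    (hk'_pos : 1 ≤ k') (hk'_le : k' ≤ p - 1) (hk' : k ≡ k' [MOD (p - 1)])
    (hk_pos : 0 < k) (hk_le : k ≤ min (StirlingPole.digit p c 0) k' * p ^ h) :
    (k' ≤ StirlingPole.digitSum p n →
      ∃ n' : ℕ, StirlingPole.IsBottomSegment p n n' ∧
        IsLeast {m : ℕ | StirlingPole.IsSegment p n m ∧ StirlingPole.digitSum p m = k'} n' ∧
        k ≤ n' ∧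
        (StirlingPole.maxPole p (StirlingPole.hoBernoulli (-(k : ℤ)) (n - k)) : ℚ) =
          (StirlingPole.digitSum p (n' - k) : ℚ) / ((p : ℚ) - 1) ∧
        (StirlingPole.amzEstimate p n k : ℚ) =
          ((StirlingPole.digitSum p k : ℚ) - (k' : ℚ)) / ((p : ℚ) - 1) ∧
        ((StirlingPole.digitSum p k : ℚ) - (k' : ℚ)) / ((p : ℚ) - 1) ≤
          (padicValNat p (Nat.stirlingSecond n k) : ℚ)) ∧
    (n ≡ k [MOD (p - 1)] →
      StirlingPole.IsAMZC p n k ∧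
        (padicValNat p (Nat.stirlingSecond n k) : ℚ) =
          ((StirlingPole.digitSum p k : ℚ) - (k' : ℚ)) / ((p : ℚ) - 1)) := by
  open StirlingPole in
  have := Fact.mk hp
  have h1 := hp.one_lt
  have hk'p : k' < p := by omega
  have hmin : 1 ≤ min (digit p c 0) k' := by
    by_contra! h0
    rw [Nat.lt_one_iff.1 h0, zero_mul] at hk_le
    omega
  have hc : 1 ≤ digit p c 0 := hmin.trans (min_le_left _ _)
  have hkr : k ≤ k' * p ^ h := hk_le.trans (Nat.mul_le_mul_right _ (min_le_right _ _))
  have hdigc : ∀ d, digit p d 0 ≤ d := fun d => by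
    simpa [digit] using Nat.mod_le d p
  have hkn : k ≤ n := hn ▸ hk_le.trans
    (Nat.mul_le_mul_right _ ((min_le_left _ _).trans (hdigc c)))
  obtain ⟨V, hV, hkV⟩ := exists_digitSum_eq hp hk'p hk_pos hk'
  have hp1 : ((p - 1 : ℕ) : ℚ) = (p : ℚ) - 1 := by
    rw [Nat.cast_sub hp.one_le, Nat.cast_one]
  have hp0 : (p : ℚ) - 1 ≠ 0 := by
    rw [← hp1]
    exact Nat.cast_ne_zero.2 (by omega)
  have hVq : ((digitSum p k : ℚ) - (k' : ℚ)) / ((p : ℚ) - 1) = V := by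
    rw [hV, div_eq_iff hp0, ← hp1]
    push_cast
    ring
  rw [hVq]
  have hdvd : ∀ m ≤ n, p ^ V ∣ n.choose m * Nat.stirlingSecond m k := fun m hm => by
    subst hn
    exact pow_dvd_choose_mul_stirlingSecond hp hk'_pos hk'p hkV hc hkr hm
  have hS : Nat.stirlingSecond n k ≠ 0 := (stirlingSecond_pos hk_pos hkn).ne'
  have hSV : V ≤ padicValNat p (Nat.stirlingSecond n k) := by
    have := hdvd n le_rfl
    rwa [Nat.choose_self, one_mul, padicValNat_dvd_iff_le hS] at this
  have hestimate : k' ≤ digitSum p n → ∃ n' : ℕ, IsBottomSegment p n n' ∧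
        IsLeast {m : ℕ | IsSegment p n m ∧ digitSum p m = k'} n' ∧ k ≤ n' ∧
        (maxPole p (hoBernoulli (-(k : ℤ)) (n - k)) : ℚ) =
          (digitSum p (n' - k) : ℚ) / ((p : ℚ) - 1) ∧ amzEstimate p n k = V := by
    intro hs
    subst hn
    obtain ⟨c', hbot, hleast, hdig, hle, hsub⟩ :=
      exists_bottomSegment_mul_pow hp hk'p hs
    have hkn' : k ≤ c' * p ^ h := hk_le.trans
      (Nat.mul_le_mul_right _ (hdig.trans (hdigc c')))
    have hσ := hleast.1.2
    -- The digit sums of `n'` and `n - n'` add up to that of `n`, so Kummer's theorem gives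
    -- valuation `0`.
    have hchoose : padicValNat p ((c * p ^ h).choose (c' * p ^ h)) = 0 := by
      have h2 := sub_one_mul_padicValNat_choose hp hle
      have h3 := hsub _ le_rfl
      rw [Nat.sub_self, digitSum_zero] at h3
      have h4 : (p - 1) * padicValNat p ((c * p ^ h).choose (c' * p ^ h)) = 0 := by omega
      exact (Nat.mul_eq_zero.1 h4).resolve_left (by omega)
    have hndvd : ¬ p ^ (V + 1) ∣
        (c * p ^ h).choose (c' * p ^ h) * Nat.stirlingSecond (c' * p ^ h) k := by
      -- Applied to `n'` in place of `n`: `n' ≡ σ_p(n') = k'` modulo `p - 1` even when `n` itself is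
      -- not congruent to `k`.
      have h2 := not_pow_succ_dvd_stirlingSecond hp (h := h) hk'_pos hk'p hkV
        (hmin.trans hdig) hkr (hσ ▸ modEq_digitSum h1 _)
      have h3 := (stirlingSecond_pos hk_pos hkn').ne'
      have h4 := (Nat.choose_pos hle).ne'
      rw [padicValNat_dvd_iff_le h3] at h2
      rw [padicValNat_dvd_iff_le (mul_ne_zero h4 h3), padicValNat.mul h4 h3, hchoose, zero_add]
      exact h2
    obtain ⟨hVle, hpole⟩ := maxPole_hoBernoulli_eq hp hk_pos hkn hdvd hle hndvd
    refine ⟨c' * p ^ h, hbot, hleast, hkn', ?_, ?_⟩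
    · rw [eq_div_iff hp0, ← hp1, hpole]
      have h2 := sub_one_mul_padicValNat_choose hp hkn
      have h3 := hsub k hkn'
      have h4 : (padicValNat p ((c * p ^ h).choose k) - V) * (p - 1) =
          digitSum p (c' * p ^ h - k) := by
        rw [mul_comm, Nat.mul_sub]
        omega
      exact_mod_cast h4
    · rw [amzEstimate, hpole]
      omega
  refine ⟨fun hs => ?_, fun hnk => ?_⟩
  · obtain ⟨n', hbot, hleast, hkn', hpole, hamz⟩ := hestimate hs
    exact ⟨n', hbot, hleast, hkn', hpole, by rw [hamz]; simp, by exact_mod_cast hSV⟩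
  · have hnk' : n ≡ k' [MOD (p - 1)] := hnk.trans hk'
    have hs : k' ≤ digitSum p n := by
      obtain ⟨N, hN⟩ := exists_eq_add_mul_of_modEq hk'_le (digitSum_pos h1 (hk_pos.trans_le hkn))
        ((modEq_digitSum h1 n).symm.trans hnk')
      omega
    obtain ⟨n', -, -, -, -, hamz⟩ := hestimate hs
    have hval : padicValNat p (Nat.stirlingSecond n k) = V := by
      subst hn
      have h2 := not_pow_succ_dvd_stirlingSecond hp hk'_pos hk'p hkV hc hkr hnk'
      rw [padicValNat_dvd_iff_le hS] at h2
      omega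
    exact ⟨by rw [IsAMZC, hamz, hval], by rw [hval]⟩
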